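/- Let $\ell, s, k$ be positive integers and $n = \ell s$. Let $D$ be an arbitrary initial deck of $n$ cards, each of one of $k$ types, and let $p_i$ be the number of cards of type $i$ in $D$ (equal types may repeat and need not be consecutive). An $a$-shuffle cuts the deck into $a$ consecutive packets of sizes $m_1,\dots,m_a$ with probability $\binom{n}{m_1,\dots,m_a}a^{-n}$ and then chooses uniformly one of the interleavings of the packets that keep the relative order of the cards of each packet. The shuffled deck is dealt to $\ell$ players, $s$ cards each, by one of the following methods. - Ordered dealing: player 1 gets the first $s$ cards, player 2 the next $s$ cards, and so on. - Cyclic dealing: in each of $s$ rounds the players $1,2,\dots,\ell$ get one card each, in this order. - Back-and-forth dealing: as cyclic dealing, but with the order of the players reversed in every second round. Let $\Omega$ be the set of possible hands, that is, of arrays $\omega = (p_{i,j})_{1\le i\le k,\,1\le j\le \ell}$ of nonnegative integers with $\sum_i p_{i,j} = s$ for all $j$ and $\sum_j p_{i,j} = p_i$ for all $i$, where $p_{i,j}$ is the number of cards of type $i$ received by player $j$. Let $\mathbb P_a(\omega)$ be the probability of $\omega$ after an $a$-shuffle of $D$ and dealing, and let $$\Pi(\omega) = \frac{s!^{\ell}}{(\ell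 s)!}\prod_{i=1}^k \frac{p_i!}{\prod_{j=1}^{\ell} p_{i,j}!},$$ the probability of $\omega$ when a uniformly random arrangement of the deck is dealt. Theorem. For each of the three dealing methods there is a (necessarily unique) real number $c$ with $$\frac12\sum_{\omega\in\Omega}\left|\mathbb P_a(\omega)-\Pi(\omega)\right| = c\,a^{-1} + O(a^{-2})\qquad (a\to\infty).$$ Let $c_{\mathrm{ord}}, c_{\mathrm{cyc}}, c_{\mathrm{bf}}$ be these coefficients for ordered, cyclic and back-and-forth dealing of the same deck $D$. Then $c_{\mathrm{ord}} = s\,c_{\mathrm{cyc}}$. If $s$ is even, then $c_{\mathrm{bf}} = 0$. If $s$ is odd, then $c_{\mathrm{cyc}} = s\,c_{\mathrm{bf}}$. -/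

import Mathlib

open Finset Asymptotics Filter

/-- When a deck is cut into `a` consecutive packets of sizes `m 0, m 1, …` (from the top),
packet `j` starts at this position (positions are numbered from `0`). -/
def packetStart {a : ℕ} (m : Fin a → ℕ) (j : Fin a) : ℕ := ∑ j' ∈ Finset.Iio j, m j'

/-- The positions, in a deck of `n` cards, of the cards of packet `j`. -/
def packet {a : ℕ} (n : ℕ) (m : Fin a → ℕ) (j : Fin a) : Finset (Fin n) :=
  Finset.univ.filter fun i => packetStart m j ≤ (i : ℕ) ∧ (i : ℕ) < packetStart m j + m j

/-- The interleavings of the packets of sizes `m`. A permutation `π` moves the card in position `i`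
to position `π i`; it is an interleaving if the cards of each packet keep their relative order. -/
def interleavings {a : ℕ} (n : ℕ) (m : Fin a → ℕ) : Finset (Equiv.Perm (Fin n)) :=
  Finset.univ.filter fun π =>
    ∀ j : Fin a, ∀ i ∈ packet n m j, ∀ i' ∈ packet n m j, i < i' → π i < π i'

/-- The probability of the permutation `π` in an `a`-shuffle of `n` cards: the deck is cut into `a`
packets of sizes `m` with the multinomial probability, and then one of the interleavings of these
packets is chosen uniformly. -/
noncomputable def shuffleProb (a : ℕ) {n : ℕ} (π : Equiv.Perm (Fin n)) : ℝ :=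
  ∑ m ∈ Finset.piAntidiag (Finset.univ : Finset (Fin a)) n,
    (Nat.multinomial Finset.univ m : ℝ) / (a : ℝ) ^ n *
      (if π ∈ interleavings n m then 1 / ((interleavings n m).card : ℝ) else 0)

/-- The probability that an `a`-shuffle transforms the deck `D` into the deck `D'`
(a deck lists the card types from the top). -/
noncomputable def transitionProb (a : ℕ) {n k : ℕ} (D D' : Fin n → Fin k) : ℝ :=
  ∑ π : Equiv.Perm (Fin n) with (∀ i, D' (π i) = D i), shuffleProb a π

/-- The number of cards of type `i` in the deck `D`. -/
def typeCount {n k : ℕ} (D : Fin n → Fin k) (i : Fin k) : ℕ :=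
  (Finset.univ.filter fun q => D q = i).card

/-- The hands obtained by giving, for each position `q`, the card in position `q` of the deck `D'`
to player `deal q`: the entry `(i, j)` is the number of cards of type `i` that player `j` gets. -/
def hands {n k ℓ : ℕ} (deal : Fin n → Fin ℓ) (D' : Fin n → Fin k) : Fin k → Fin ℓ → ℕ :=
  fun i j => (Finset.univ.filter fun q => D' q = i ∧ deal q = j).card

/-- All possible hands: every player gets `s` cards, and the cards of type `i` dealt are
exactly those of the deck `D`. -/
def allHands {ℓ s k : ℕ} (D : Fin (ℓ * s) → Fin k) : Finset (Fin k → Fin ℓ → ℕ) :=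
  (Fintype.piFinset fun i => Finset.piAntidiag Finset.univ (typeCount D i)).filter
    fun ω => ∀ j, ∑ i, ω i j = s

/-- The probability of the hands `ω` when the deck `D` is `a`-shuffled and dealt by `deal`. -/
noncomputable def handsProb (a : ℕ) {n k ℓ : ℕ} (deal : Fin n → Fin ℓ) (D : Fin n → Fin k)
    (ω : Fin k → Fin ℓ → ℕ) : ℝ :=
  ∑ D' : Fin n → Fin k with hands deal D' = ω, transitionProb a D D'

/-- The stationary probability of the hands `ω`, which is their probability when a uniformly random
arrangement of the deck `D` is dealt. -/
noncomputable def stationaryProb {ℓ s k : ℕ} (D : Fin (ℓ * s) → Fin k)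
    (ω : Fin k → Fin ℓ → ℕ) : ℝ :=
  (s.factorial : ℝ) ^ ℓ / ((ℓ * s).factorial : ℝ) *
    ∏ i, ((typeCount D i).factorial : ℝ) / ∏ j, ((ω i j).factorial : ℝ)

/-- The variation distance, from stationarity, of the hands after an `a`-shuffle of `D`. -/
noncomputable def variationDist (a : ℕ) {ℓ s k : ℕ} (deal : Fin (ℓ * s) → Fin ℓ)
    (D : Fin (ℓ * s) → Fin k) : ℝ :=
  1 / 2 * ∑ ω ∈ allHands D, |handsProb a deal D ω - stationaryProb D ω|

/-- Ordered dealing: player `0` gets the first `s` cards, player `1` the next `s` cards, … -/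
def orderedDeal (ℓ s : ℕ) (q : Fin (ℓ * s)) : Fin ℓ :=
  ⟨q / s, Nat.div_lt_of_lt_mul (Nat.mul_comm ℓ s ▸ q.isLt)⟩

/-- Cyclic dealing: in each round the players `0, 1, …, ℓ - 1` get one card each, in this order. -/
def cyclicDeal (ℓ s : ℕ) (q : Fin (ℓ * s)) : Fin ℓ :=
  ⟨q % ℓ, Nat.mod_lt _ (Nat.pos_of_mul_pos_right (Nat.zero_lt_of_lt q.isLt))⟩

/-- Back and forth dealing: as cyclic dealing, with the order of the players
reversed in every second round. -/
def backForthDeal (ℓ s : ℕ) (q : Fin (ℓ * s)) : Fin ℓ :=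
  if Even ((q : ℕ) / ℓ) then cyclicDeal ℓ s q else Fin.rev (cyclicDeal ℓ s q)

/-- `c` is the coefficient of `a⁻¹` in `f`, that is `f a = c a⁻¹ + O(a⁻²)` as `a → ∞`.
There is at most one such `c`. -/
def IsFirstOrderCoeff (f : ℕ → ℝ) (c : ℝ) : Prop :=
  (fun a : ℕ => f a - c * (a : ℝ)⁻¹) =O[atTop] fun a : ℕ => ((a : ℝ) ^ 2)⁻¹

/-! ### Counting permutations and functions with prescribed fibres. -/

section Counting

variable {α β : Type*} [Fintype α] [DecidableEq β]

/-! To first order an `a`-shuffle sees only ascents, and the dealing method enters only through one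
scalar. A permutation `π` of `n` cards has probability `(a + asc π).choose n / a ^ n`
(`shuffleProb_eq_choose`). Its expansion is `1/n!` times `1 + (n/2) S(π) a⁻¹ + O(a⁻²)`, where `S(π)`
sums the signs of `π y - π x` over adjacent positions `x, y`.

Group the permutations that give hands `ω` by `h = deal ∘ π`, which says who receives each card of
the original deck. Within a group, if `h x ≠ h y`, the pair `(π x, π y)` is uniform over the pairs
of positions dealt to `h x` and `h y`. So the mean sign is `dealWeight deal (h x) (h y) / s²`
(`sq_mul_sum_perm_orderSign`).

For all three methods `dealWeight deal j j' = κ * orderSign j j'`, with `κ = s²` (ordered), `κ = s`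
(cyclic) and, for back-and-forth, `κ = 1` or `0` as `s` is odd or even. The coefficient for `ω` is
then `κ * handsCoeff D ω`, whose second factor does not depend on the method. Since `κ ≥ 0`, it
survives absolute values and the sum over `ω`, and the three coefficients are in the ratio of the
`κ`. -/

theorem exists_perm_comp_eq_of_card_fiber {d h : α → β}
    (H : ∀ b, #{x | d x = b} = #{x | h x = b}) : ∃ σ : Equiv.Perm α, d ∘ σ = h := by
  have e : ∀ b, Nonempty ({x // h x = b} ≃ {x // d x = b}) := fun b =>
    Fintype.card_eq.1 (by rw [Fintype.card_subtype, Fintype.card_subtype, H])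
  refine ⟨Equiv.ofFiberEquiv fun b => (e b).some, ?_⟩
  funext x
  exact Equiv.ofFiberEquiv_map _ x

/-- The solutions form a coset of the stabilizer of `d`, which is a product of symmetric groups on
the fibres. -/
theorem card_perm_comp_eq [DecidableEq α] [Fintype β] {d h : α → β}
    (H : ∀ b, #{x | d x = b} = #{x | h x = b}) :
    #{σ : Equiv.Perm α | d ∘ σ = h} = ∏ b, (#{x | d x = b}).factorial := by
  obtain ⟨τ, rfl⟩ := exists_perm_comp_eq_of_card_fiber H
  have := DomMulAct.stabilizer_card d
  simp only [Fintype.card_subtype] at this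
  rw [← this]
  refine card_bij' (fun σ _ => σ * τ⁻¹) (fun σ _ => σ * τ) ?_ ?_ ?_ ?_
  · intro σ hσ
    simp only [mem_filter, mem_univ, true_and] at hσ ⊢
    rw [Equiv.Perm.coe_mul, ← Function.comp_assoc, hσ]
    funext x
    simp
  · intro σ hσ
    simp only [mem_filter, mem_univ, true_and] at hσ ⊢
    rw [Equiv.Perm.coe_mul, ← Function.comp_assoc, hσ]
  · simp
  · simp

theorem exists_fun_card_fiber [Fintype β] {m : β → ℕ} (hm : ∑ b, m b = Fintype.card α) :
    ∃ f : α → β, ∀ b, #{x | f x = b} = m b := by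
  have e : α ≃ Σ b, Fin (m b) := Fintype.equivOfCardEq (by simp [hm])
  refine ⟨fun x => (e x).1, fun b => ?_⟩
  rw [← Fintype.card_subtype, Fintype.card_congr (e.subtypeEquiv (q := fun y => y.1 = b) (by simp)),
    Fintype.card_congr (Equiv.sigmaSubtype b), Fintype.card_fin]

theorem card_filter_card_fiber_eq [DecidableEq α] [Fintype β] {m : β → ℕ}
    (hm : ∑ b, m b = Fintype.card α) :
    #{f : α → β | ∀ b, #{x | f x = b} = m b} = Nat.multinomial univ m := by
  obtain ⟨f₀, hf₀⟩ := exists_fun_card_fiber hm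
  -- Sort all permutations by `f₀ ∘ σ`: each class has `∏ b, (m b)!` elements.
  have h1 : (univ : Finset (Equiv.Perm α)).card = ∑ f : α → β with ∀ b, #{x | f x = b} = m b,
      #{σ : Equiv.Perm α | f₀ ∘ σ = f} := by
    refine card_eq_sum_card_fiberwise fun σ _ => ?_
    simp only [coe_filter, Set.mem_ofPred_eq, mem_univ, true_and, Function.comp_apply]
    intro b
    rw [← hf₀ b]
    exact card_equiv σ (by simp)
  rw [sum_congr rfl (g := fun _ => ∏ b, (m b).factorial), sum_const, card_univ,
    Fintype.card_perm, ← hm, ← Nat.multinomial_spec, smul_eq_mul, mul_comm] at h1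
  · exact (Nat.eq_of_mul_eq_mul_right (prod_pos fun b _ => Nat.factorial_pos _) h1).symm
  · intro f hf
    simp only [mem_filter, mem_univ, true_and] at hf
    rw [card_perm_comp_eq fun b => (hf₀ b).trans (hf b).symm]
    simp_rw [hf₀]

end Counting

/-! ### Cuts as monotone maps, interleavings as labellings. -/

section Packets

variable {a n : ℕ}

theorem packetStart_card_fiber (g : Fin n → Fin a) (j : Fin a) :
    packetStart (fun j => #{x | g x = j}) j = #{x | g x < j} := by
  rw [packetStart, card_eq_sum_card_fiberwise (f := g) (t := Iio j) (by intro x; simp)]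
  refine sum_congr rfl fun b hb => ?_
  congr 1
  ext x
  simp only [mem_filter, mem_univ, true_and, mem_Iio] at hb ⊢
  grind

theorem packetStart_add_card_fiber (g : Fin n → Fin a) (j : Fin a) :
    packetStart (fun j => #{x | g x = j}) j + #{x | g x = j} = #{x | g x ≤ j} := by
  rw [packetStart_card_fiber, ← card_union_of_disjoint]
  · congr 1
    ext x
    simp [le_iff_lt_or_eq]
  · rw [disjoint_filter]
    intro x _ h
    exact h.ne

theorem mem_packet_card_fiber {g : Fin n → Fin a} (hg : Monotone g) (i : Fin n) (j : Fin a) :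
    i ∈ packet n (fun j => #{x | g x = j}) j ↔ g i = j := by
  simp only [packet, mem_filter, mem_univ, true_and]
  rw [packetStart_add_card_fiber, packetStart_card_fiber,
    Tuple.lt_card_le_iff_apply_le_of_monotone hg, ← not_lt,
    Tuple.lt_card_lt_iff_apply_lt_of_monotone hg]
  grind

theorem Monotone.eq_of_card_fiber_eq {g g' : Fin n → Fin a} (hg : Monotone g) (hg' : Monotone g')
    (h : ∀ j, #{x | g x = j} = #{x | g' x = j}) : g = g' := by
  funext i
  rw [← mem_packet_card_fiber hg i, funext h]
  exact (mem_packet_card_fiber hg' i _).2 rfl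

theorem mem_interleavings_card_fiber {g : Fin n → Fin a} (hg : Monotone g)
    (π : Equiv.Perm (Fin n)) :
    π ∈ interleavings n (fun j => #{x | g x = j}) ↔
      ∀ i i', i < i' → g i = g i' → π i < π i' := by
  simp only [interleavings, mem_filter, mem_univ, true_and, mem_packet_card_fiber hg]
  exact ⟨fun h i i' hi e => h _ i rfl i' e.symm hi,
    fun h j i hi i' hi' hlt => h i i' hlt (hi.trans hi'.symm)⟩

theorem exists_monotone_card_fiber {m : Fin a → ℕ} (hm : m ∈ piAntidiag univ n) :
    ∃ g : Fin n → Fin a, Monotone g ∧ (fun j => #{x | g x = j}) = m := by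
  obtain ⟨f, hf⟩ := exists_fun_card_fiber (α := Fin n) (m := m) (by simpa using hm)
  refine ⟨f ∘ Tuple.sort f, Tuple.monotone_sort f, ?_⟩
  funext j
  rw [← hf j]
  exact card_equiv (Tuple.sort f) (by simp)

/-- Label each position of the shuffled deck by the packet its card came from. The interleaving is
recovered from the labelling `f` as the stable sort of `f`, so interleavings correspond to functions
with fibre sizes `m`. -/
theorem card_interleavings {m : Fin a → ℕ} (hm : m ∈ piAntidiag univ n) :
    (interleavings n m).card = Nat.multinomial univ m := by
  rw [← card_filter_card_fiber_eq (α := Fin n) (by simpa using hm)]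
  obtain ⟨g, hg, rfl⟩ := exists_monotone_card_fiber hm
  have key : ∀ f : Fin n → Fin a, (∀ j, #{x | f x = j} = #{x | g x = j}) →
      f ∘ Tuple.sort f = g := by
    intro f hf
    refine (Tuple.monotone_sort f).eq_of_card_fiber_eq hg fun j => ?_
    rw [← hf]
    exact card_equiv (Tuple.sort f) (by simp)
  symm
  refine card_bij (fun f _ => Tuple.sort f) ?_ ?_ ?_
  · intro f hf
    rw [mem_interleavings_card_fiber hg, ← key f (by simpa using hf)]
    exact (Tuple.eq_sort_iff.1 rfl).2
  · intro f hf f' hf' h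
    have h1 := key f (by simpa using hf)
    rw [← key f' (by simpa using hf'), h] at h1
    exact (Tuple.sort f').surjective.injective_comp_right h1
  · intro π hπ
    rw [mem_interleavings_card_fiber hg] at hπ
    refine ⟨g ∘ π.symm, ?_, ?_⟩
    · simp only [mem_filter, mem_univ, true_and]
      intro j
      exact card_equiv π.symm (by simp)
    · symm
      rw [Tuple.eq_sort_iff]
      refine ⟨?_, by simpa using hπ⟩
      rw [Function.comp_assoc, Equiv.symm_comp_self]
      exact hg

/-- The multinomial weight of a cut cancels the number of its interleavings, so each cut compatible
with `π` contributes `a⁻ⁿ`. -/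
theorem shuffleProb_eq_card (a : ℕ) (π : Equiv.Perm (Fin n)) :
    shuffleProb a π = (#{g : Fin n → Fin a | Monotone g ∧
      ∀ i i', i < i' → g i = g i' → π i < π i'} : ℝ) / (a : ℝ) ^ n := by
  have h1 : #{g : Fin n → Fin a | Monotone g ∧ ∀ i i', i < i' → g i = g i' → π i < π i'} =
      #{m ∈ piAntidiag (univ : Finset (Fin a)) n | π ∈ interleavings n m} := by
    refine card_bij (fun g _ j => #{x | g x = j}) ?_ ?_ ?_
    · intro g hg
      simp only [mem_filter, mem_univ, true_and] at hg
      rw [mem_filter, mem_interleavings_card_fiber hg.1]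
      refine ⟨?_, hg.2⟩
      simp only [mem_piAntidiag, mem_univ, implies_true, and_true]
      rw [← card_eq_sum_card_fiberwise (by intro; simp)]
      simp
    · intro g hg g' hg' h
      simp only [mem_filter, mem_univ, true_and] at hg hg'
      exact hg.1.eq_of_card_fiber_eq hg'.1 (congrFun h)
    · intro m hm
      rw [mem_filter] at hm
      obtain ⟨g, hg, rfl⟩ := exists_monotone_card_fiber hm.1
      exact ⟨g, by simpa using ⟨hg, (mem_interleavings_card_fiber hg π).1 hm.2⟩, rfl⟩
  rw [h1, shuffleProb, card_filter, Nat.cast_sum, sum_div]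
  refine sum_congr rfl fun m hm => ?_
  split_ifs
  · rw [card_interleavings hm]
    have : (Nat.multinomial univ m : ℝ) ≠ 0 := by
      exact_mod_cast (Nat.multinomial_pos _ _).ne'
    field_simp
    simp
  · simp

end Packets

/-! ### The shuffle probability in terms of ascents. -/

/-- The pairs of adjacent positions in a deck of `n` cards. -/
def adjacentPositions (n : ℕ) : Finset (Fin n × Fin n) :=
  univ.filter fun p => (p.1 : ℕ) + 1 = p.2

/-- The number of ascents of a permutation. -/
def ascentCount {n : ℕ} (π : Equiv.Perm (Fin n)) : ℕ :=
  #{p ∈ adjacentPositions n | π p.1 < π p.2}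

theorem sum_adjacentPositions_succ {M : Type*} [AddCommMonoid M] {n : ℕ}
    (F : Fin (n + 1) → Fin (n + 1) → M) :
    ∑ p ∈ adjacentPositions (n + 1), F p.1 p.2 = ∑ t : Fin n, F t.castSucc t.succ := by
  symm
  refine sum_bij (fun t _ => (t.castSucc, t.succ)) ?_ ?_ ?_ ?_
  · intro t _
    simp [adjacentPositions]
  · intro t _ t' _ h
    exact Fin.castSucc_injective _ (Prod.ext_iff.1 h).1
  · rintro ⟨x, y⟩ hp
    simp only [adjacentPositions, mem_filter, mem_univ, true_and] at hp
    exact ⟨⟨x, by omega⟩, mem_univ _, Prod.ext rfl (Fin.ext hp)⟩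
  · intros
    rfl

theorem card_filter_strictMono (n M : ℕ) :
    #{f : Fin n → Fin M | StrictMono f} = M.choose n := by
  rw [← Fintype.card_subtype]
  have e : {f : Fin n → Fin M // StrictMono f} ≃ (Fin n ↪o Fin M) :=
    { toFun := fun f => OrderEmbedding.ofStrictMono f.1 f.2
      invFun := fun f => ⟨f, f.strictMono⟩
      left_inv := fun _ => rfl
      right_inv := fun _ => by ext; rfl }
  rw [Fintype.card_congr (e.trans Set.powersetCard.ofFinEmbEquiv), ← Nat.card_eq_fintype_card,
    Set.powersetCard.card, Nat.card_eq_fintype_card, Fintype.card_fin]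

/-- Adding `u` is a bijection onto the strictly increasing maps into `Fin (a + u (Fin.last n))`. As
`u` grows by at most one per step, subtracting it from such a map leaves a monotone one, so only the
two ends need bounding. -/
theorem card_filter_strictMono_add {a n : ℕ} {u : Fin (n + 1) → ℕ} (h0 : u 0 = 0)
    (hu : Monotone u) (hs : ∀ t : Fin n, u t.succ ≤ u t.castSucc + 1) :
    #{g : Fin (n + 1) → Fin a | StrictMono fun i => (g i : ℕ) + u i} =
      (a + u (Fin.last n)).choose (n + 1) := by
  rw [← card_filter_strictMono]
  refine card_bij (fun g _ i => ⟨g i + u i, add_lt_add_of_lt_of_le (g i).2 (hu (Fin.le_last i))⟩)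
    ?_ ?_ ?_
  · intro g hg
    simp only [mem_filter, mem_univ, true_and] at hg ⊢
    exact fun i j hij => hg hij
  · intro g _ g' _ h
    funext i
    have := congrArg Fin.val (congrFun h i)
    exact Fin.ext (Nat.add_right_cancel this)
  · intro f hf
    simp only [mem_filter, mem_univ, true_and] at hf
    have hm : Monotone fun i => ((f i : ℕ) : ℤ) - u i := by
      rw [Fin.monotone_iff_le_succ]
      intro t
      have h1 := hs t
      have h2 : ((f t.castSucc : Fin _) : ℕ) < f t.succ := hf Fin.castSucc_lt_succ
      omega
    have hlo : ∀ i, u i ≤ f i := fun i => by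
      have := hm (Fin.zero_le i)
      simp only [h0] at this
      omega
    have hhi : ∀ i, (f i : ℕ) - u i < a := fun i => by
      have h1 := hm (Fin.le_last i)
      have h2 := (f (Fin.last n)).2
      have h3 := hlo i
      simp only at h1
      omega
    have he : ∀ i, (f i : ℕ) - u i + u i = f i := fun i => Nat.sub_add_cancel (hlo i)
    refine ⟨fun i => ⟨f i - u i, hhi i⟩, ?_, ?_⟩
    · simp only [mem_filter, mem_univ, true_and, he]
      exact fun i j hij => hf hij
    · funext i
      exact Fin.ext (he i)

theorem shuffleProb_eq_choose (a : ℕ) {n : ℕ} (π : Equiv.Perm (Fin n)) :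
    shuffleProb a π = ((a + ascentCount π).choose n : ℝ) / (a : ℝ) ^ n := by
  rw [shuffleProb_eq_card]
  congr 2
  obtain _ | n := n
  · rw [Nat.choose_zero_right, filter_true_of_mem, card_univ]
    · simp
    · intro g _
      exact ⟨fun i => i.elim0, fun i => i.elim0⟩
  -- `u i` counts the ascents of `π` before `i`. A compatible `g` may stay constant at an ascent but
  -- must increase at a descent; adding `u` makes both conditions strict increase.
  set u : Fin (n + 1) → ℕ := fun i => #{t : Fin n | t.castSucc < i ∧ π t.castSucc < π t.succ}
    with hu
  have hlast : ascentCount π = u (Fin.last n) := by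
    rw [ascentCount, card_filter,
      sum_adjacentPositions_succ fun x y => if π x < π y then 1 else 0, ← card_filter]
    simp [hu, Fin.castSucc_lt_last]
  have hstep : ∀ t : Fin n,
      u t.succ = u t.castSucc + if π t.castSucc < π t.succ then 1 else 0 := by
    intro t
    simp only [hu, card_filter]
    have h0 : (if π t.castSucc < π t.succ then 1 else 0) =
        ∑ t' : Fin n, if t' = t then if π t.castSucc < π t.succ then 1 else 0 else 0 := by
      simp
    rw [h0, ← sum_add_distrib]
    refine sum_congr rfl fun t' _ => ?_
    rcases lt_trichotomy t' t with h | rfl | h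
    · have h1 : t'.castSucc < t.succ := by rw [Fin.castSucc_lt_succ_iff]; exact h.le
      simp [h, h1, h.ne]
    · simp
    · have h1 : ¬ t'.castSucc < t.succ := by rw [Fin.castSucc_lt_succ_iff]; exact not_le.2 h
      simp [h.not_gt, h1, h.ne']
  rw [hlast, ← card_filter_strictMono_add]
  · congr 1
    ext g
    simp only [mem_filter, mem_univ, true_and]
    trans StrictMono fun i => toLex (g i, π i)
    · constructor
      · rintro ⟨hg, h⟩ i j hij
        rw [Prod.Lex.toLex_lt_toLex]
        rcases (hg hij.le).lt_or_eq with h1 | h1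
        · exact Or.inl h1
        · exact Or.inr ⟨h1, h i j hij h1⟩
      · intro h
        constructor
        · intro i j hij
          exact (Prod.Lex.toLex_le_toLex.1 (h.monotone hij)).elim le_of_lt fun h => h.1.le
        · intro i j hij e
          exact ((Prod.Lex.toLex_lt_toLex.1 (h hij)).resolve_left (by simp [e])).2
    · rw [Fin.strictMono_iff_lt_succ, Fin.strictMono_iff_lt_succ]
      refine forall_congr' fun t => ?_
      rw [Prod.Lex.toLex_lt_toLex, hstep, Fin.lt_def, Fin.ext_iff]
      split_ifs with h
      · simp only [h, and_true]
        omega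
      · simp only [h, and_false, or_false]
        omega
  · simp [hu]
  · rw [Fin.monotone_iff_le_succ]
    intro t
    rw [hstep]
    omega
  · intro t
    rw [hstep]
    split_ifs <;> omega

/-! ### Calculus of first order coefficients. -/

section Expansion

theorem IsFirstOrderCoeff.mul_one_add {f : ℕ → ℝ} {c : ℝ}
    (hf : IsFirstOrderCoeff (fun a => f a - 1) c) (d : ℝ) :
    IsFirstOrderCoeff (fun a => f a * (1 + d * (a : ℝ)⁻¹) - 1) (c + d) := by
  unfold IsFirstOrderCoeff at *
  have h1 : (fun a : ℕ => 1 + d * (a : ℝ)⁻¹) =O[atTop] fun _ => (1 : ℝ) := by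
    have : Tendsto (fun a : ℕ => 1 + d * (a : ℝ)⁻¹) atTop (nhds (1 + d * 0)) :=
      tendsto_const_nhds.add (tendsto_inv_atTop_nhds_zero_nat.const_mul d)
    exact this.isBigO_one ℝ
  have h0 := hf.mul h1
  simp only [mul_one] at h0
  have h2 := h0.add
    ((isBigO_refl (fun a : ℕ => ((a : ℝ) ^ 2)⁻¹) atTop).const_mul_left (c * d))
  refine h2.congr_left fun a => ?_
  rw [← inv_pow]
  ring

theorem IsFirstOrderCoeff.sum {ι : Type*} {s : Finset ι} {f : ι → ℕ → ℝ} {c : ι → ℝ}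
    (h : ∀ i ∈ s, IsFirstOrderCoeff (f i) (c i)) :
    IsFirstOrderCoeff (fun a => ∑ i ∈ s, f i a) (∑ i ∈ s, c i) := by
  unfold IsFirstOrderCoeff at *
  refine (IsBigO.fun_sum h).congr_left fun a => ?_
  rw [sum_sub_distrib, sum_mul]

theorem IsFirstOrderCoeff.const_mul {f : ℕ → ℝ} {c : ℝ} (h : IsFirstOrderCoeff f c) (b : ℝ) :
    IsFirstOrderCoeff (fun a => b * f a) (b * c) := by
  unfold IsFirstOrderCoeff at *
  refine (h.const_mul_left b).congr_left fun a => ?_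
  ring

theorem IsFirstOrderCoeff.abs {f : ℕ → ℝ} {c : ℝ} (h : IsFirstOrderCoeff f c) :
    IsFirstOrderCoeff (fun a => |f a|) |c| := by
  unfold IsFirstOrderCoeff at *
  refine IsBigO.trans (IsBigO.of_bound 1 (Eventually.of_forall fun a => ?_)) h
  have h1 : |c| * (a : ℝ)⁻¹ = |c * (a : ℝ)⁻¹| := by
    rw [abs_mul, abs_of_nonneg (a := (a : ℝ)⁻¹) (inv_nonneg.2 (Nat.cast_nonneg a))]
  rw [h1, one_mul]
  exact abs_abs_sub_abs_le _ _

theorem IsFirstOrderCoeff.congr {f g : ℕ → ℝ} {c : ℝ} (h : IsFirstOrderCoeff f c)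
    (hfg : ∀ᶠ a in atTop, f a = g a) : IsFirstOrderCoeff g c := by
  unfold IsFirstOrderCoeff at *
  refine h.congr' ?_ EventuallyEq.rfl
  filter_upwards [hfg] with a ha
  rw [ha]

theorem isFirstOrderCoeff_prod_one_add (d : ℕ → ℝ) (n : ℕ) :
    IsFirstOrderCoeff (fun a => ∏ i ∈ range n, (1 + d i * (a : ℝ)⁻¹) - 1) (∑ i ∈ range n, d i) := by
  induction n with
  | zero =>
    simp only [prod_range_zero, sum_range_zero, sub_self, IsFirstOrderCoeff, zero_mul]
    exact isBigO_zero _ _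
  | succ n ih =>
    simp only [prod_range_succ, sum_range_succ]
    exact ih.mul_one_add (d n)

theorem isFirstOrderCoeff_choose (r n : ℕ) :
    IsFirstOrderCoeff (fun a => ((a + r).choose n : ℝ) / (a : ℝ) ^ n - 1 / (n.factorial : ℝ))
      (1 / (n.factorial : ℝ) * ((n : ℝ) / 2 * (2 * r - (n - 1)))) := by
  -- The factors of the falling factorial are `a + r - i`, and each contributes `r - i`.
  have hsum : ∑ i ∈ range n, ((r : ℝ) - i) = (n : ℝ) / 2 * (2 * r - (n - 1)) := by
    induction n with
    | zero => simp
    | succ n ih => rw [sum_range_succ, ih]; push_cast; ring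
  rw [← hsum]
  refine ((isFirstOrderCoeff_prod_one_add (fun i => (r : ℝ) - i) n).const_mul _).congr ?_
  filter_upwards [eventually_ne_atTop 0] with a ha
  have ha' : (a : ℝ) ≠ 0 := Nat.cast_ne_zero.2 ha
  rw [Nat.cast_choose_eq_descPochhammer_div, descPochhammer_eval_eq_prod_range]
  have : ∏ i ∈ range n, ((((a + r : ℕ) : ℝ)) - i) =
      (a : ℝ) ^ n * ∏ i ∈ range n, (1 + ((r : ℝ) - i) * (a : ℝ)⁻¹) := by
    rw [← card_range n, ← prod_const, card_range, ← prod_mul_distrib]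
    refine prod_congr rfl fun i _ => ?_
    push_cast
    field_simp
    ring
  rw [this]
  field_simp

end Expansion

/-! ### The first order term as a sum of signs. -/

section Sign

/-- The sign of `y - x`. -/
def orderSign {α : Type*} [LinearOrder α] (x y : α) : ℝ :=
  if x < y then 1 else if y < x then -1 else 0

theorem orderSign_swap {α : Type*} [LinearOrder α] (x y : α) : orderSign x y = -orderSign y x := by
  unfold orderSign
  rcases lt_trichotomy x y with h | h | h
  · simp [h, h.not_gt]
  · simp [h]
  · simp [h, h.not_gt]

@[simp] theorem orderSign_self {α : Type*} [LinearOrder α] (x : α) : orderSign x x = 0 := by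
  simp [orderSign]

/-- Ascents count `1` and descents `-1` among the `n - 1` adjacent pairs. The factor `n / 2` makes
this hold for `n = 0` too. -/
theorem sum_orderSign_adjacentPositions {n : ℕ} (π : Equiv.Perm (Fin n)) :
    (n : ℝ) / 2 * ∑ p ∈ adjacentPositions n, orderSign (π p.1) (π p.2) =
      (n : ℝ) / 2 * (2 * ascentCount π - (n - 1)) := by
  obtain _ | n := n
  · simp
  congr 1
  rw [ascentCount, card_filter,
    sum_adjacentPositions_succ fun x y => orderSign (π x) (π y),
    sum_adjacentPositions_succ fun x y => if π x < π y then 1 else 0]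
  have hn : ((n + 1 : ℕ) : ℝ) - 1 = ∑ t : Fin n, 1 := by simp
  rw [hn, Nat.cast_sum, mul_sum, ← sum_sub_distrib]
  refine sum_congr rfl fun t _ => ?_
  unfold orderSign
  have hne : π t.castSucc ≠ π t.succ := π.injective.ne Fin.castSucc_lt_succ.ne
  rcases hne.lt_or_gt with h | h
  · simp [h]
    norm_num
  · simp [h, h.not_gt]

theorem isFirstOrderCoeff_shuffleProb {n : ℕ} (π : Equiv.Perm (Fin n)) :
    IsFirstOrderCoeff (fun a => shuffleProb a π - 1 / (n.factorial : ℝ))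
      (1 / (n.factorial : ℝ) *
        ((n : ℝ) / 2 * ∑ p ∈ adjacentPositions n, orderSign (π p.1) (π p.2))) := by
  rw [sum_orderSign_adjacentPositions]
  simp_rw [shuffleProb_eq_choose]
  exact isFirstOrderCoeff_choose _ _

end Sign

/-! ### Hands as sums over permutations. -/

section Hands

variable {n k ℓ : ℕ}

theorem hands_comp_symm (deal : Fin n → Fin ℓ) (D : Fin n → Fin k) (π : Equiv.Perm (Fin n)) :
    hands deal (D ∘ π.symm) = hands (deal ∘ π) D := by
  funext i j
  exact card_equiv π.symm (by simp)

theorem handsProb_eq_sum (a : ℕ) (deal : Fin n → Fin ℓ) (D : Fin n → Fin k)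
    (ω : Fin k → Fin ℓ → ℕ) :
    handsProb a deal D ω =
      ∑ π ∈ {π : Equiv.Perm (Fin n) | hands (deal ∘ π) D = ω}, shuffleProb a π := by
  rw [handsProb, ← sum_fiberwise_of_maps_to (g := fun π : Equiv.Perm (Fin n) => D ∘ π.symm)
    (t := univ.filter fun D' => hands deal D' = ω)]
  · refine sum_congr rfl fun D' hD' => ?_
    rw [transitionProb]
    refine sum_congr ?_ fun _ _ => rfl
    ext π
    simp only [mem_filter, mem_univ, true_and] at hD' ⊢
    constructor
    · intro h
      have : D ∘ π.symm = D' := by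
        funext x
        rw [Function.comp_apply, ← h, Equiv.apply_symm_apply]
      rw [← hands_comp_symm, this]
      exact ⟨hD', rfl⟩
    · rintro ⟨-, rfl⟩ i
      simp
  · intro π hπ
    simpa [hands_comp_symm] using hπ

theorem sum_perm_hands_eq {M : Type*} [AddCommMonoid M] (deal : Fin n → Fin ℓ) (D : Fin n → Fin k)
    (ω : Fin k → Fin ℓ → ℕ) (F : Equiv.Perm (Fin n) → M) :
    ∑ π ∈ {π : Equiv.Perm (Fin n) | hands (deal ∘ π) D = ω}, F π =
      ∑ h : Fin n → Fin ℓ with hands h D = ω,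
        ∑ π ∈ {π : Equiv.Perm (Fin n) | deal ∘ π = h}, F π := by
  rw [← sum_fiberwise_of_maps_to (g := fun π : Equiv.Perm (Fin n) => deal ∘ π)
    (t := univ.filter fun h => hands h D = ω) (by intro π; simp)]
  refine sum_congr rfl fun h hh => sum_congr ?_ fun _ _ => rfl
  ext π
  simp only [mem_filter, mem_univ, true_and] at hh ⊢
  constructor
  · exact fun h => h.2
  · rintro rfl
    exact ⟨hh, rfl⟩

/-- Assigning players to cards splits into independent assignments for each card type. -/
theorem card_filter_hands_eq {D : Fin n → Fin k} {ω : Fin k → Fin ℓ → ℕ}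
    (hω : ∀ i, ∑ j, ω i j = typeCount D i) :
    #{h : Fin n → Fin ℓ | hands h D = ω} = ∏ i, Nat.multinomial univ (ω i) := by
  have hcard : ∀ i, ∑ j, ω i j = Fintype.card {q // D q = i} := fun i => by
    rw [hω, Fintype.card_subtype]
    rfl
  have key : ∀ (h : Fin n → Fin ℓ) i j,
      #{q : {q // D q = i} | h q = j} = hands h D i j := fun h i j => by
    rw [hands, ← card_map (Function.Embedding.subtype fun q => D q = i)]
    congr 1
    ext q
    simp [and_comm]
  rw [prod_congr rfl fun i _ => (card_filter_card_fiber_eq (hcard i)).symm, ← Fintype.card_piFinset]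
  refine card_bij (fun h _ i q => h q) ?_ ?_ ?_
  · intro h hh
    simp only [mem_filter, mem_univ, true_and, Fintype.mem_piFinset, key] at hh ⊢
    simp [hh]
  · intro h _ h' _ e
    funext q
    exact congrFun (congrFun e (D q)) ⟨q, rfl⟩
  · intro F hF
    simp only [mem_filter, mem_univ, true_and, Fintype.mem_piFinset] at hF
    have e : (fun i (q : {q // D q = i}) => F (D q) ⟨q, rfl⟩) = F := by
      funext i ⟨q, hq⟩
      subst hq
      rfl
    refine ⟨fun q => F (D q) ⟨q, rfl⟩, ?_, e⟩
    simp only [mem_filter, mem_univ, true_and]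
    funext i j
    rw [← hF i j, ← key]
    rw [← congrFun e i]

theorem sum_hands (h : Fin n → Fin ℓ) (D : Fin n → Fin k) (j : Fin ℓ) :
    ∑ i, hands h D i j = #{q | h q = j} := by
  rw [card_eq_sum_card_fiberwise (f := D) (t := univ) (by intro; simp)]
  refine sum_congr rfl fun i _ => ?_
  rw [filter_filter]
  simp only [hands, and_comm]

end Hands

/-! ### Balanced dealing and the stationary law. -/

section Balanced

variable {ℓ s k : ℕ}

theorem card_perm_comp_eq_of_balanced {n : ℕ} {deal h : Fin n → Fin ℓ}
    (hd : ∀ j, #{q | deal q = j} = s) (hh : ∀ j, #{q | h q = j} = s) :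
    #{π : Equiv.Perm (Fin n) | deal ∘ π = h} = s.factorial ^ ℓ := by
  rw [card_perm_comp_eq fun j => (hd j).trans (hh j).symm]
  simp [hd]

theorem mem_allHands {D : Fin (ℓ * s) → Fin k} {ω : Fin k → Fin ℓ → ℕ} :
    ω ∈ allHands D ↔ (∀ i, ∑ j, ω i j = typeCount D i) ∧ ∀ j, ∑ i, ω i j = s := by
  simp [allHands]

theorem stationaryProb_eq {deal : Fin (ℓ * s) → Fin ℓ} (hd : ∀ j, #{q | deal q = j} = s)
    {D : Fin (ℓ * s) → Fin k} {ω : Fin k → Fin ℓ → ℕ} (hω : ω ∈ allHands D) :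
    stationaryProb D ω =
      ∑ _π ∈ {π : Equiv.Perm (Fin (ℓ * s)) | hands (deal ∘ π) D = ω},
        1 / ((ℓ * s).factorial : ℝ) := by
  rw [mem_allHands] at hω
  have h1 : ∀ h ∈ univ.filter fun h : Fin (ℓ * s) → Fin ℓ => hands h D = ω,
      ∑ _π ∈ {π : Equiv.Perm (Fin (ℓ * s)) | deal ∘ π = h}, 1 / ((ℓ * s).factorial : ℝ) =
        (s.factorial : ℝ) ^ ℓ / ((ℓ * s).factorial : ℝ) := fun h hh => by
    simp only [mem_filter, mem_univ, true_and] at hh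
    rw [sum_const, card_perm_comp_eq_of_balanced hd fun j => by rw [← sum_hands h D, hh, hω.2],
      nsmul_eq_mul]
    push_cast
    ring
  rw [sum_perm_hands_eq, sum_congr rfl h1, sum_const, card_filter_hands_eq hω.1, nsmul_eq_mul,
    stationaryProb, mul_comm]
  push_cast
  congr 1
  refine prod_congr rfl fun i _ => ?_
  rw [← hω.1 i, ← Nat.multinomial_spec]
  have : ∏ j, ((ω i j).factorial : ℝ) ≠ 0 :=
    prod_ne_zero_iff.2 fun j _ => Nat.cast_ne_zero.2 (Nat.factorial_ne_zero _)
  push_cast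
  field_simp

end Balanced

/-! ### Averaging signs over permutations with the same `deal ∘ π`. -/

section Averaging

variable {α β : Type*} [Fintype α] [DecidableEq α] [DecidableEq β]

/-- Composing `π` with the transposition of `π x` and `u` moves the image of `x` to any position of
the same player, and fixes `π y`, which belongs to another player. -/
theorem card_mul_sum_perm_comp_eq {d h : α → β} {x y : α} (hxy : h x ≠ h y) (G : α → α → ℝ) :
    (#{u | d u = h x} : ℝ) * ∑ π ∈ {π : Equiv.Perm α | d ∘ π = h}, G (π x) (π y) =
      ∑ π ∈ {π : Equiv.Perm α | d ∘ π = h}, ∑ u with d u = h x, G u (π y) := by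
  have hne : ∀ (π : Equiv.Perm α) (u : α), d ∘ π = h → d u = h x →
      Equiv.swap u (π x) (π y) = π y := by
    intro π u hπ hu
    refine Equiv.swap_apply_of_ne_of_ne ?_ ?_
    · rintro rfl
      exact hxy (hu.symm.trans (congrFun hπ y))
    · exact fun e => hxy (congrArg h (π.injective e)).symm
  have hmem : ∀ (π : Equiv.Perm α) (u : α), d ∘ π = h → d u = h x →
      d ∘ (Equiv.swap u (π x) * π) = h := by
    intro π u hπ hu
    rw [← hπ]
    funext z
    have h1 : d (π x) = h x := congrFun hπ x
    simp only [Function.comp_apply, Equiv.Perm.mul_apply, Equiv.swap_apply_def]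
    split_ifs with h2 h3
    · rw [h2, hu, h1]
    · rw [h3, hu, h1]
    · rfl
  rw [← nsmul_eq_mul, ← sum_const, sum_comm, ← sum_product', ← sum_product']
  -- This map is an involution: the second component remembers the old image of `x`.
  refine sum_nbij' (fun p => (Equiv.swap p.2 (p.1 x) * p.1, p.1 x))
    (fun p => (Equiv.swap p.2 (p.1 x) * p.1, p.1 x)) ?_ ?_ ?_ ?_ ?_
  · rintro ⟨π, u⟩ hp
    simp only [mem_product, mem_filter, mem_univ, true_and] at hp ⊢
    exact ⟨hmem π u hp.1 hp.2, congrFun hp.1 x⟩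
  · rintro ⟨π, u⟩ hp
    simp only [mem_product, mem_filter, mem_univ, true_and] at hp ⊢
    exact ⟨hmem π u hp.1 hp.2, congrFun hp.1 x⟩
  · rintro ⟨π, u⟩ hp
    simp [← mul_assoc, Equiv.swap_comm u]
  · rintro ⟨π, u⟩ hp
    simp [← mul_assoc, Equiv.swap_comm u]
  · rintro ⟨π, u⟩ hp
    simp only [mem_product, mem_filter, mem_univ, true_and] at hp
    simp only [Equiv.Perm.mul_apply, hne π u hp.1 hp.2]

/-- The sum of the signs of all pairs of a position dealt to `j` and a position dealt to `j'`. -/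
noncomputable def dealWeight {ℓ n : ℕ} (deal : Fin n → Fin ℓ) (j j' : Fin ℓ) : ℝ :=
  ∑ u with deal u = j, ∑ v with deal v = j', orderSign u v

theorem dealWeight_self {ℓ n : ℕ} (deal : Fin n → Fin ℓ) (j : Fin ℓ) : dealWeight deal j j = 0 := by
  have h : dealWeight deal j j = -dealWeight deal j j := by
    conv_lhs => rw [dealWeight, sum_comm]
    simp only [dealWeight, ← sum_neg_distrib]
    exact sum_congr rfl fun u _ => sum_congr rfl fun v _ => orderSign_swap _ _
  linarith

theorem sum_perm_orderSign_eq_zero {n : ℕ} {d h : Fin n → β} {x y : Fin n} (hxy : h x = h y) :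
    ∑ π ∈ {π : Equiv.Perm (Fin n) | d ∘ π = h}, orderSign (π x) (π y) = 0 := by
  have h1 : ∑ π ∈ {π : Equiv.Perm (Fin n) | d ∘ π = h}, orderSign (π x) (π y) =
      ∑ π ∈ {π : Equiv.Perm (Fin n) | d ∘ π = h}, orderSign (π y) (π x) := by
    -- Exchanging two cards of one player preserves `d ∘ π` and reverses the sign.
    have hmem : ∀ π : Equiv.Perm (Fin n), d ∘ π = h → d ∘ (π * Equiv.swap x y) = h := by
      rintro π rfl
      funext z
      simp only [Function.comp_apply, Equiv.Perm.mul_apply, Equiv.swap_apply_def] at hxy ⊢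
      split_ifs with h2 h3
      · rw [h2, hxy]
      · rw [h3, hxy]
      · rfl
    refine sum_nbij' (fun π => π * Equiv.swap x y) (fun π => π * Equiv.swap x y) ?_ ?_ ?_ ?_ ?_
    · intro π
      simpa using hmem π
    · intro π
      simpa using hmem π
    · simp [mul_assoc]
    · simp [mul_assoc]
    · simp
  have h2 : ∑ π ∈ {π : Equiv.Perm (Fin n) | d ∘ π = h}, orderSign (π y) (π x) =
      -∑ π ∈ {π : Equiv.Perm (Fin n) | d ∘ π = h}, orderSign (π x) (π y) := by
    rw [← sum_neg_distrib]
    exact sum_congr rfl fun π _ => orderSign_swap _ _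
  linarith

theorem sq_mul_sum_perm_orderSign {n ℓ s : ℕ} {deal h : Fin n → Fin ℓ}
    (hd : ∀ j, #{q | deal q = j} = s) (hh : ∀ j, #{q | h q = j} = s) (x y : Fin n) :
    (s : ℝ) ^ 2 * ∑ π ∈ {π : Equiv.Perm (Fin n) | deal ∘ π = h}, orderSign (π x) (π y) =
      (s.factorial : ℝ) ^ ℓ * dealWeight deal (h x) (h y) := by
  by_cases hxy : h x = h y
  · rw [sum_perm_orderSign_eq_zero hxy, hxy, dealWeight_self, mul_zero, mul_zero]
  have h1 := card_mul_sum_perm_comp_eq (d := deal) hxy orderSign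
  have h2 := card_mul_sum_perm_comp_eq (d := deal) (Ne.symm hxy)
    fun v _ => ∑ u with deal u = h x, orderSign u v
  rw [hd] at h1 h2
  rw [pow_two, mul_assoc, h1, h2, sum_const, card_perm_comp_eq_of_balanced hd hh, nsmul_eq_mul,
    dealWeight, sum_comm]
  push_cast
  rfl

end Averaging

/-! ### Weights of the three dealing methods. -/

section Deals

variable {ℓ s : ℕ}

theorem sum_filter_deal_eq {M : Type*} [AddCommMonoid M] {n : ℕ} {deal : Fin n → Fin ℓ}
    (e : Fin ℓ × Fin s ≃ Fin n) (he : ∀ p, deal (e p) = p.1) (j : Fin ℓ) (F : Fin n → M) :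
    ∑ u with deal u = j, F u = ∑ r, F (e (j, r)) := by
  symm
  refine sum_bij (fun r _ => e (j, r)) ?_ ?_ ?_ ?_
  · simp [he]
  · intro r _ r' _ h
    simpa using h
  · intro u hu
    simp only [mem_filter, mem_univ, true_and] at hu
    have h1 := he (e.symm u)
    rw [Equiv.apply_symm_apply, hu] at h1
    exact ⟨(e.symm u).2, mem_univ _, by rw [h1, Prod.mk.eta, Equiv.apply_symm_apply]⟩
  · simp

theorem card_filter_deal_eq {n : ℕ} {deal : Fin n → Fin ℓ}
    (e : Fin ℓ × Fin s ≃ Fin n) (he : ∀ p, deal (e p) = p.1) (j : Fin ℓ) :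
    #{u | deal u = j} = s := by
  rw [card_eq_sum_ones, sum_filter_deal_eq e he]
  simp

theorem dealWeight_eq {n : ℕ} {deal : Fin n → Fin ℓ}
    (e : Fin ℓ × Fin s ≃ Fin n) (he : ∀ p, deal (e p) = p.1) (j j' : Fin ℓ) :
    dealWeight deal j j' = ∑ r, ∑ r', orderSign (e (j, r)) (e (j', r')) := by
  rw [dealWeight, sum_filter_deal_eq e he]
  simp_rw [sum_filter_deal_eq e he]

theorem sum_sum_orderSign {α : Type*} [Fintype α] [LinearOrder α] :
    ∑ r : α, ∑ r' : α, orderSign r r' = 0 := by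
  have h : ∑ r : α, ∑ r' : α, orderSign r r' = -∑ r : α, ∑ r' : α, orderSign r r' := by
    conv_lhs => rw [sum_comm]
    simp only [← sum_neg_distrib]
    exact sum_congr rfl fun u _ => sum_congr rfl fun v _ => orderSign_swap _ _
  linarith

/-- `finProdFinEquiv` enumerates pairs lexicographically, the first component being dominant. -/
theorem orderSign_finProdFinEquiv {m n : ℕ} (p p' : Fin m × Fin n) :
    orderSign (finProdFinEquiv p) (finProdFinEquiv p') =
      orderSign p.1 p'.1 + if p.1 = p'.1 then orderSign p.2 p'.2 else 0 := by
  obtain ⟨i, j⟩ := p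
  obtain ⟨i', j'⟩ := p'
  have key : ∀ {i i' : Fin m} {j j' : Fin n}, i < i' →
      finProdFinEquiv (i, j) < finProdFinEquiv (i', j') := fun {i i' j j'} h => by
    rw [Fin.lt_def]
    simp only [finProdFinEquiv_apply_val]
    have h1 : n * ((i : ℕ) + 1) ≤ n * i' := Nat.mul_le_mul_left n h
    have h2 := j.2
    rw [mul_add] at h1
    omega
  simp only
  rcases lt_trichotomy i i' with h | rfl | h
  · simp [orderSign, h, h.ne, key h]
  · have h : ∀ j j' : Fin n, finProdFinEquiv (i, j) < finProdFinEquiv (i, j') ↔ j < j' :=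
      fun j j' => by simp only [Fin.lt_def, finProdFinEquiv_apply_val, add_lt_add_iff_right]
    simp [orderSign, h]
  · simp [orderSign, h, h.ne', key h, h.not_gt, (key h).not_gt]

theorem orderSign_rev (j j' : Fin ℓ) : orderSign j.rev j'.rev = -orderSign j j' := by
  rw [← orderSign_swap]
  simp [orderSign]

theorem orderSign_cast {m n : ℕ} (h : m = n) (x y : Fin m) :
    orderSign (Fin.cast h x) (Fin.cast h y) = orderSign x y := by
  subst h
  rfl

theorem orderedDeal_finProdFinEquiv (p : Fin ℓ × Fin s) :
    orderedDeal ℓ s (finProdFinEquiv p) = p.1 := by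
  refine Fin.ext ?_
  simp only [orderedDeal, finProdFinEquiv_apply_val]
  rw [Nat.add_mul_div_left _ _ (Nat.zero_lt_of_lt p.2.2), Nat.div_eq_of_lt p.2.2, zero_add]

theorem dealWeight_orderedDeal (j j' : Fin ℓ) :
    dealWeight (orderedDeal ℓ s) j j' = (s : ℝ) ^ 2 * orderSign j j' := by
  rw [dealWeight_eq finProdFinEquiv orderedDeal_finProdFinEquiv]
  simp_rw [orderSign_finProdFinEquiv, sum_add_distrib]
  have h : ∑ r : Fin s, ∑ r' : Fin s, (if j = j' then orderSign r r' else 0) = 0 := by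
    split_ifs
    · exact sum_sum_orderSign
    · simp
  rw [h]
  simp only [sum_const, card_univ, Fintype.card_fin, nsmul_eq_mul]
  ring

/-- The positions of the deck, by round and by place in the round, where in round `r`
the places are permuted by `σ r`. -/
def roundEquiv (σ : Fin s → Equiv.Perm (Fin ℓ)) : Fin ℓ × Fin s ≃ Fin (ℓ * s) :=
  (Equiv.prodComm _ _).trans <| (Equiv.prodShear (Equiv.refl _) σ).trans <|
    finProdFinEquiv.trans (finCongr (mul_comm s ℓ))

theorem roundEquiv_val (σ : Fin s → Equiv.Perm (Fin ℓ)) (p : Fin ℓ × Fin s) :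
    (roundEquiv σ p : ℕ) = σ p.2 p.1 + ℓ * p.2 := rfl

theorem cyclicDeal_roundEquiv (σ : Fin s → Equiv.Perm (Fin ℓ)) (p : Fin ℓ × Fin s) :
    cyclicDeal ℓ s (roundEquiv σ p) = σ p.2 p.1 := by
  refine Fin.ext ?_
  simp only [cyclicDeal, roundEquiv_val]
  rw [Nat.add_mul_mod_self_left, Nat.mod_eq_of_lt (σ p.2 p.1).2]

theorem backForthDeal_roundEquiv (p : Fin ℓ × Fin s) :
    backForthDeal ℓ s (roundEquiv (fun r => if Even (r : ℕ) then 1 else Fin.revPerm) p) = p.1 := by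
  rw [backForthDeal, cyclicDeal_roundEquiv, roundEquiv_val, Nat.add_mul_div_left _ _
    (Nat.zero_lt_of_lt p.1.2), Nat.div_eq_of_lt (Fin.is_lt _), zero_add]
  split_ifs <;> simp

/-- Between different rounds the round number alone decides the sign, so the pairs `(r, r')` and
`(r', r)` cancel; only pairs within one round remain. -/
theorem sum_sum_orderSign_roundEquiv (σ : Fin s → Equiv.Perm (Fin ℓ)) (j j' : Fin ℓ) :
    ∑ r, ∑ r', orderSign (roundEquiv σ (j, r)) (roundEquiv σ (j', r')) =
      ∑ r, orderSign (σ r j) (σ r j') := by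
  have h : ∀ r r', orderSign (roundEquiv σ (j, r)) (roundEquiv σ (j', r')) =
      orderSign r r' + if r = r' then orderSign (σ r j) (σ r' j') else 0 := fun r r' =>
    (orderSign_cast (mul_comm s ℓ) _ _).trans (orderSign_finProdFinEquiv (r, σ r j) (r', σ r' j'))
  simp_rw [h, sum_add_distrib, sum_sum_orderSign]
  simp

theorem dealWeight_cyclicDeal (j j' : Fin ℓ) :
    dealWeight (cyclicDeal ℓ s) j j' = s * orderSign j j' := by
  rw [dealWeight_eq (roundEquiv fun _ => 1) (cyclicDeal_roundEquiv _),
    sum_sum_orderSign_roundEquiv]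
  simp

/-- Successive rounds contribute alternating signs, leaving one round if `s` is odd and none if `s`
is even. -/
theorem dealWeight_backForthDeal (j j' : Fin ℓ) :
    dealWeight (backForthDeal ℓ s) j j' = (if Even s then 0 else 1) * orderSign j j' := by
  rw [dealWeight_eq _ backForthDeal_roundEquiv, sum_sum_orderSign_roundEquiv]
  have h : ∀ r : Fin s, orderSign ((if Even (r : ℕ) then 1 else Fin.revPerm : Equiv.Perm (Fin ℓ)) j)
      ((if Even (r : ℕ) then 1 else Fin.revPerm : Equiv.Perm (Fin ℓ)) j') =
        (-1 : ℝ) ^ (r : ℕ) * orderSign j j' := fun r => by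
    split_ifs with hr
    · simp [hr.neg_one_pow]
    · simp [(Nat.not_even_iff_odd.1 hr).neg_one_pow, orderSign_rev]
  simp_rw [h]
  rw [← sum_mul, Fin.sum_univ_eq_sum_range (fun r => (-1 : ℝ) ^ r), neg_one_geom_sum]

end Deals

/-! ### Coefficients for hands and variation distance. -/

section Main

variable {ℓ s k : ℕ}

/-- The first order coefficient of the probability of the hands `ω` for a dealing method of unit
weight. -/
noncomputable def handsCoeff (D : Fin (ℓ * s) → Fin k) (ω : Fin k → Fin ℓ → ℕ) : ℝ :=
  1 / ((ℓ * s).factorial : ℝ) * (((ℓ * s : ℕ) : ℝ) / 2 *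
    ∑ p ∈ adjacentPositions (ℓ * s), ∑ h : Fin (ℓ * s) → Fin ℓ with hands h D = ω,
      (s.factorial : ℝ) ^ ℓ / (s : ℝ) ^ 2 * orderSign (h p.1) (h p.2))

theorem isFirstOrderCoeff_handsProb {deal : Fin (ℓ * s) → Fin ℓ} {κ : ℝ}
    (hd : ∀ j, #{q | deal q = j} = s) (hκ : ∀ j j', dealWeight deal j j' = κ * orderSign j j')
    {D : Fin (ℓ * s) → Fin k} {ω : Fin k → Fin ℓ → ℕ} (hω : ω ∈ allHands D) :
    IsFirstOrderCoeff (fun a => handsProb a deal D ω - stationaryProb D ω)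
      (κ * handsCoeff D ω) := by
  have h1 := IsFirstOrderCoeff.sum (s := univ.filter fun π : Equiv.Perm (Fin (ℓ * s)) =>
    hands (deal ∘ π) D = ω) fun π _ => isFirstOrderCoeff_shuffleProb π
  simp_rw [handsProb_eq_sum, stationaryProb_eq hd hω, ← sum_sub_distrib]
  convert h1 using 1
  rw [← mul_sum, ← mul_sum, sum_comm, handsCoeff, mul_left_comm, mul_left_comm κ]
  -- One cannot cancel `s²` when `s = 0`, but then the factor `ℓ * s / 2` vanishes on both sides.
  obtain rfl | hs := Nat.eq_zero_or_pos s
  · simp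
  have hs' : (s : ℝ) ^ 2 ≠ 0 := pow_ne_zero _ (Nat.cast_ne_zero.2 hs.ne')
  congr 2
  rw [mul_sum]
  refine sum_congr rfl fun p _ => ?_
  rw [sum_perm_hands_eq, mul_sum]
  refine sum_congr rfl fun h hh => ?_
  simp only [mem_filter, mem_univ, true_and] at hh
  have h2 := sq_mul_sum_perm_orderSign hd
    (fun j => by rw [← sum_hands h D, hh, (mem_allHands.1 hω).2]) p.1 p.2
  rw [hκ] at h2
  rw [← mul_right_inj' hs', h2]
  field_simp

theorem isFirstOrderCoeff_variationDist {deal : Fin (ℓ * s) → Fin ℓ} {κ : ℝ} (hκ0 : 0 ≤ κ)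
    (hd : ∀ j, #{q | deal q = j} = s) (hκ : ∀ j j', dealWeight deal j j' = κ * orderSign j j')
    (D : Fin (ℓ * s) → Fin k) :
    IsFirstOrderCoeff (fun a => variationDist a deal D)
      (κ * (1 / 2 * ∑ ω ∈ allHands D, |handsCoeff D ω|)) := by
  rw [mul_left_comm, mul_sum]
  refine IsFirstOrderCoeff.const_mul (IsFirstOrderCoeff.sum fun ω hω => ?_) _
  have := (isFirstOrderCoeff_handsProb hd hκ hω).abs
  rwa [abs_mul, abs_of_nonneg hκ0] at this

end Main

theorem mainTheorem1 (ℓ s k : ℕ) (D : Fin (ℓ * s) → Fin k) :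
    ∃ cOrdered cCyclic cBackForth : ℝ,
      IsFirstOrderCoeff (fun a => variationDist a (orderedDeal ℓ s) D) cOrdered ∧
      IsFirstOrderCoeff (fun a => variationDist a (cyclicDeal ℓ s) D) cCyclic ∧
      IsFirstOrderCoeff (fun a => variationDist a (backForthDeal ℓ s) D) cBackForth ∧
      cOrdered = s * cCyclic ∧
      (Even s → cBackForth = 0) ∧
      (Odd s → cCyclic = s * cBackForth) := by
  refine ⟨_, _, _,
    isFirstOrderCoeff_variationDist (by positivity)
      (card_filter_deal_eq finProdFinEquiv orderedDeal_finProdFinEquiv) dealWeight_orderedDeal D,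
    isFirstOrderCoeff_variationDist (by positivity)
      (card_filter_deal_eq (roundEquiv fun _ => 1) (cyclicDeal_roundEquiv _))
      dealWeight_cyclicDeal D,
    isFirstOrderCoeff_variationDist (by split_ifs <;> norm_num)
      (card_filter_deal_eq _ backForthDeal_roundEquiv) dealWeight_backForthDeal D, ?_, ?_, ?_⟩
  · ring
  · intro h
    simp [h]
  · intro h
    simp [Nat.not_even_iff_odd.2 h]
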